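/- A continuous t-norm is a commutative, associative, continuous binary operation $\&$ on $[0,1]$ that is monotone in each variable and has $1$ as unit; its implication is $p\to r=\sup\{q\in[0,1] : p\& q\le r\}$. It satisfies condition (S) if $\to\colon[0,1]^2\to[0,1]$ is continuous at every point off the diagonal $\{(x,x) : x\in[0,1]\}$. Fix a continuous t-norm $\&$. A $[0,1]$-ordered set is a set $X$ with a map $X(-,-)\colon X\times X\to[0,1]$ such that $X(x,x)=1$ and $X(y,z)\& X(x,y)\le X(x,z)$ for all $x,y,z\in X$; it is separated if $X(x,y)=X(y,x)=1$ implies $x=y$. Its opposite is $X^{\mathrm{op}}(x,y)=X(y,x)$. A map $f\colon X\to Y$ preserves $[0,1]$-order if $X(x,y)\le Y(f(x),f(y))$ for all $x,y$; a map $f\colon X\to Y$ is left adjoint to $g\colon Y\to X$, written $f\dashv g$, if $Y(f(x),y)=X(x,g(y))$ for all $x,y$. Let $\alpha_L(x,y)=x\to y$ on $[0,1]$, and for a set $A$ let the power $([0,1],\alpha_L)^A$ be the set $[0,1]^A$ with the $[0,1]$-order $(\vec x,\vec y)\mapsto\bigwedge_{i\in A}(x_i\to y_i)$. A weight of $X$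 is a map $\phi\colon X\to[0,1]$ with $\phi(y)\& X(x,y)\le\phi(x)$ for all $x,y$. Put $\mathrm{sub}_X(\phi,\psi)=\bigwedge_{x\in X}(\phi(x)\to\psi(x))$. An element $a$ is a supremum of a weight $\phi$ if $X(a,y)=\mathrm{sub}_X(\phi,X(-,y))$ for all $y\in X$. $X$ is cocomplete if every weight of $X$ has a supremum, and complete if $X^{\mathrm{op}}$ is cocomplete; a complete $[0,1]$-lattice is a separated complete $[0,1]$-ordered set. For $f\colon X\to Y$ let $f^{\rightarrow}(\phi)(y)=\bigvee_{x\in X}\phi(x)\& Y(y,f(x))$. A net $(x_i)_i$ in $X$ is forward Cauchy if $\bigvee_i\bigwedge_{i\le j\le l}X(x_j,x_l)=1$, and a weight is forward Cauchy if it equals $\bigvee_i\bigwedge_{j\ge i}X(-,x_j)$ for some forward Cauchy net. Let $\mathcal DX$ be the set of forward Cauchy weights of $X$ with the $[0,1]$-order $\mathrm{sub}_X$, and let $\mathsf y\colon X\to\mathcal DX$, $\mathsf y(x)=X(-,x)$. A separated $X$ is a $[0,1]$-domain if there are maps $\sup\colon\mathcal DX\to X$ and $\mathsf d\colon X\to\mathcal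 DX$ with $\mathsf d\dashv\sup\dashv\mathsf y$; a continuous $[0,1]$-lattice is a complete $[0,1]$-lattice that is also a $[0,1]$-domain. A map $f\colon X\to Y$ of $[0,1]$-ordered sets is $[0,1]$-Scott continuous if it preserves $[0,1]$-order and, whenever $a$ is a supremum of a forward Cauchy weight $\phi$ of $X$, $f(a)$ is a supremum of $f^{\rightarrow}(\phi)$. $X$ is a retract of $Y$ in the category $[0,1]\text{-}\mathsf{Ord}^{\uparrow}$ of $[0,1]$-ordered sets and $[0,1]$-Scott continuous maps if there are $[0,1]$-Scott continuous maps $s\colon X\to Y$ and $r\colon Y\to X$ with $r\circ s=\mathrm{id}_X$. **Proposition.** Let $\&$ be a continuous t-norm satisfying condition (S). A $[0,1]$-ordered set $X$ is a continuous $[0,1]$-lattice if and only if there is a set $A$ such that $X$ is a retract of $([0,1],\alpha_L)^A$ in the category $[0,1]\text{-}\mathsf{Ord}^{\uparrow}$. -/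

import Mathlib

open scoped unitInterval

universe u v

noncomputable section

/-- A continuous t-norm on the unit interval: a commutative, associative, monotone and
(jointly) continuous binary operation with unit `1`. -/
structure ContinuousTNorm where
  mul : I → I → I
  mul_comm : ∀ p q, mul p q = mul q p
  mul_assoc : ∀ p q r, mul (mul p q) r = mul p (mul q r)
  mul_one : ∀ p, mul p 1 = p
  mul_mono : ∀ p q r, q ≤ r → mul p q ≤ mul p r
  continuous_mul : Continuous fun z : I × I => mul z.1 z.2

namespace ContinuousTNorm

variable (T : ContinuousTNorm)

/-- The implication `p → r`, the largest `q` with `p & q ≤ r`. -/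
def imp (p r : I) : I := sSup {q | T.mul p q ≤ r}

/-- Condition (S): the implication is continuous at each point off the diagonal. -/
def ConditionS : Prop :=
  ∀ x y : I, x ≠ y → ContinuousAt (fun z : I × I => T.imp z.1 z.2) (x, y)

theorem mul_le_left (p q : I) : T.mul p q ≤ p :=
  (T.mul_mono p q 1 unitInterval.le_one').trans (T.mul_one p).le

theorem mul_zero (p : I) : T.mul p 0 = 0 :=
  le_antisymm ((T.mul_comm p 0).le.trans (T.mul_le_left 0 p)) unitInterval.nonneg'

theorem mul_sSup (p : I) (S : Set I) : T.mul p (sSup S) = sSup (T.mul p '' S) :=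
  Monotone.map_sSup_of_continuousAt (f := T.mul p)
    ((T.continuous_mul.comp (Continuous.prodMk_right p)).continuousAt)
    (fun q r h => T.mul_mono p q r h) (T.mul_zero p)

theorem mul_iSup {ι : Sort*} (p : I) (f : ι → I) :
    T.mul p (⨆ i, f i) = ⨆ i, T.mul p (f i) := by
  rw [iSup, T.mul_sSup, ← Set.range_comp]
  rfl

/-- The adjoint property that determines the implication. -/
theorem mul_le_iff (p q r : I) : T.mul p q ≤ r ↔ q ≤ T.imp p r := by
  refine ⟨fun h => le_sSup h, fun h => (T.mul_mono p _ _ h).trans ?_⟩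
  rw [imp, T.mul_sSup]
  exact sSup_le (by rintro _ ⟨q, hq, rfl⟩; exact hq)

theorem mul_imp_le (p r : I) : T.mul p (T.imp p r) ≤ r := (T.mul_le_iff _ _ _).2 le_rfl

theorem imp_self (p : I) : T.imp p p = 1 :=
  le_antisymm unitInterval.le_one' ((T.mul_le_iff _ _ _).1 (T.mul_one p).le)

theorem mul_mono_left {p q : I} (r : I) (h : p ≤ q) : T.mul p r ≤ T.mul q r := by
  rw [T.mul_comm p, T.mul_comm q]; exact T.mul_mono _ _ _ h

theorem imp_trans (p q r : I) : T.mul (T.imp q r) (T.imp p q) ≤ T.imp p r := by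
  rw [← T.mul_le_iff, T.mul_comm (T.imp q r), ← T.mul_assoc]
  exact (T.mul_mono_left _ (T.mul_imp_le p q)).trans (T.mul_imp_le q r)

end ContinuousTNorm

/-- A `[0,1]`-ordered set with respect to the t-norm `T`; `hom x y` is `X(x,y)`. -/
structure IOrd (T : ContinuousTNorm) where
  carrier : Type u
  hom : carrier → carrier → I
  one_le_hom_self : ∀ x, 1 ≤ hom x x
  hom_trans : ∀ x y z, T.mul (hom y z) (hom x y) ≤ hom x z

namespace IOrd

variable {T : ContinuousTNorm}

instance : CoeSort (IOrd.{u} T) (Type u) := ⟨IOrd.carrier⟩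

/-- The opposite `[0,1]`-ordered set. -/
def op (X : IOrd.{u} T) : IOrd.{u} T where
  carrier := X
  hom x y := X.hom y x
  one_le_hom_self := X.one_le_hom_self
  hom_trans x y z := (T.mul_comm _ _).le.trans (X.hom_trans z y x)

/-- Isomorphic elements are identical. -/
def IsSeparated (X : IOrd.{u} T) : Prop :=
  ∀ x y : X, 1 ≤ X.hom x y ⊓ X.hom y x → x = y

def PreservesOrder {X : IOrd.{u} T} {Y : IOrd.{v} T} (f : X → Y) : Prop :=
  ∀ x y, X.hom x y ≤ Y.hom (f x) (f y)

/-- `f` is left adjoint to `g`. -/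
def IsAdjoint {X : IOrd.{u} T} {Y : IOrd.{v} T} (f : X → Y) (g : Y → X) : Prop :=
  ∀ x y, Y.hom (f x) y = X.hom x (g y)

/-- The product of a family of `[0,1]`-ordered sets. -/
def pi {ι : Type v} (X : ι → IOrd.{u} T) : IOrd.{max v u} T where
  carrier := ∀ i, X i
  hom x y := ⨅ i, (X i).hom (x i) (y i)
  one_le_hom_self _ := le_iInf fun i => (X i).one_le_hom_self _
  hom_trans x y z := le_iInf fun i =>
    ((T.mul_mono_left _ (iInf_le _ i)).trans (T.mul_mono _ _ _ (iInf_le _ i))).trans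
      ((X i).hom_trans (x i) (y i) (z i))

/-- The `[0,1]`-ordered set `([0,1], α_L)`, where `α_L(x,y) = x → y`. -/
def alphaL (T : ContinuousTNorm) : IOrd.{0} T where
  carrier := I
  hom x y := T.imp x y
  one_le_hom_self x := (T.imp_self x).ge
  hom_trans x y z := T.imp_trans x y z

/-- A weight (lower fuzzy set) of `X`. -/
structure Weight (X : IOrd.{u} T) where
  val : X → I
  lower : ∀ x y, T.mul (val y) (X.hom x y) ≤ val x

/-- The fuzzy inclusion order `sub_X`. -/
def sub {A : Type u} (T : ContinuousTNorm) (φ ψ : A → I) : I := ⨅ x, T.imp (φ x) (ψ x)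

/-- The weight `X(-,x)`. -/
def yonedaWeight (X : IOrd.{u} T) (x : X) : Weight X where
  val z := X.hom z x
  lower y z := X.hom_trans y z x

/-- `a` is a supremum of the weight `φ`. -/
def IsSupremum {X : IOrd.{u} T} (φ : Weight X) (a : X) : Prop :=
  ∀ y, X.hom a y = sub T φ.val (yonedaWeight X y).val

/-- `f^→(φ)(y) = ⋁ₓ φ(x) & Y(y, f(x))`. -/
def Weight.map {X : IOrd.{u} T} {Y : IOrd.{v} T} (f : X → Y) (φ : Weight X) : Weight Y where
  val y := ⨆ x, T.mul (φ.val x) (Y.hom y (f x))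
  lower y z := by
    rw [T.mul_comm, T.mul_iSup]
    refine iSup_mono fun x => ?_
    rw [T.mul_comm, T.mul_assoc]
    exact T.mul_mono _ _ _ (Y.hom_trans _ _ _)

def IsCocomplete (X : IOrd.{u} T) : Prop := ∀ φ : Weight X, ∃ a, IsSupremum φ a

def IsComplete (X : IOrd.{u} T) : Prop := IsCocomplete X.op

/-- Complete `[0,1]`-lattices. -/
def IsCompleteLattice (X : IOrd.{u} T) : Prop := X.IsSeparated ∧ X.IsComplete

/-- The net `x` is forward Cauchy. -/
def IsForwardCauchyNet (X : IOrd.{u} T) {ι : Type v} [Preorder ι] (x : ι → X) : Prop :=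
  (⨆ i, ⨅ j, ⨅ l, ⨅ _ : i ≤ j ∧ j ≤ l, X.hom (x j) (x l)) = 1

/-- The weight `φ` is of the form `⋁ᵢ ⋀_{j ≥ i} X(-,xⱼ)` for some forward Cauchy net. -/
def IsForwardCauchy {X : IOrd.{u} T} (φ : Weight X) : Prop :=
  ∃ (ι : Type u) (_ : Preorder ι) (_ : IsDirectedOrder ι) (_ : Nonempty ι) (x : ι → X),
    IsForwardCauchyNet X x ∧ ∀ z, φ.val z = ⨆ i, ⨅ j, ⨅ _ : i ≤ j, X.hom z (x j)

theorem isForwardCauchy_yonedaWeight (X : IOrd.{u} T) (x : X) :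
    IsForwardCauchy (yonedaWeight X x) := by
  refine ⟨PUnit, inferInstance, inferInstance, inferInstance, fun _ => x, ?_, fun z => ?_⟩
  · refine le_antisymm unitInterval.le_one' ?_
    refine le_iSup_of_le PUnit.unit ?_
    exact le_iInf fun _ => le_iInf fun _ => le_iInf fun _ => X.one_le_hom_self x
  · simp [yonedaWeight]

/-- The `[0,1]`-ordered set `𝒟X` of forward Cauchy weights, ordered by fuzzy inclusion. -/
def forwardCauchyWeights (X : IOrd.{u} T) : IOrd.{u} T where
  carrier := {φ : Weight X // IsForwardCauchy φ}
  hom φ ψ := sub T φ.1.val ψ.1.val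
  one_le_hom_self _ := le_iInf fun _ => (T.imp_self _).ge
  hom_trans _ _ _ := le_iInf fun x =>
    ((T.mul_mono_left _ (iInf_le _ x)).trans (T.mul_mono _ _ _ (iInf_le _ x))).trans
      (T.imp_trans _ _ _)

/-- The Yoneda embedding `X → 𝒟X`. -/
def yoneda (X : IOrd.{u} T) (x : X) : forwardCauchyWeights X :=
  ⟨yonedaWeight X x, isForwardCauchy_yonedaWeight X x⟩

/-- `X` is a `[0,1]`-domain: it is separated and there are adjunctions `d ⊣ sup ⊣ y`. -/
def IsDomain (X : IOrd.{u} T) : Prop :=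
  X.IsSeparated ∧ ∃ (d : X → forwardCauchyWeights X) (sup : forwardCauchyWeights X → X),
    IsAdjoint d sup ∧ IsAdjoint sup X.yoneda

/-- Continuous `[0,1]`-lattices. -/
def IsContinuousLattice (X : IOrd.{u} T) : Prop := X.IsCompleteLattice ∧ X.IsDomain

/-- `[0,1]`-Scott continuous maps. -/
def IsScottContinuous {X : IOrd.{u} T} {Y : IOrd.{v} T} (f : X → Y) : Prop :=
  PreservesOrder f ∧
    ∀ φ : Weight X, IsForwardCauchy φ → ∀ a, IsSupremum φ a → IsSupremum (φ.map f) (f a)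

/-- `X` is a retract of `Y` in the category of `[0,1]`-ordered sets and
`[0,1]`-Scott continuous maps. -/
def IsRetract (X : IOrd.{u} T) (Y : IOrd.{v} T) : Prop :=
  ∃ (s : X → Y) (r : Y → X), IsScottContinuous s ∧ IsScottContinuous r ∧ ∀ x, r (s x) = x

end IOrd

end

namespace ContinuousTNorm

variable (T : ContinuousTNorm)

/-! Being a domain amounts to every `x` having a forward Cauchy weight with supremum `x` that lies
below each forward Cauchy weight of supremum `a` to degree `X(x,a)` (`isDomain_iff`). A Scott
retraction pushes such weights forward, and cocompleteness also passes to retracts; so it suffices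
that the cube is a continuous lattice. There the weight is generated by finitely supported points
strictly below `x`, and (S) makes each coordinate approximable (`exists_forall_lt_hom_le_imp`).
Conversely, `X` embeds in the cube over its own underlying set by `x ↦ d x`; the retraction takes
weighted suprema. It preserves suprema as a left adjoint, while `d` does so by interpolation.
Replacing forward Cauchy nets by flatness reduces the closure properties to finite choices. -/

theorem one_mul (p : I) : T.mul 1 p = p := by rw [T.mul_comm, T.mul_one]

theorem mul_le_mul {p q r s : I} (h : p ≤ q) (h' : r ≤ s) : T.mul p r ≤ T.mul q s :=
  (T.mul_mono_left _ h).trans (T.mul_mono _ _ _ h')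

theorem imp_mono {p q r s : I} (h : q ≤ p) (h' : r ≤ s) : T.imp p r ≤ T.imp q s :=
  (T.mul_le_iff _ _ _).1 ((T.mul_mono_left _ h).trans ((T.mul_imp_le p r).trans h'))

theorem le_imp_iff (p q r : I) : q ≤ T.imp p r ↔ T.mul q p ≤ r := by
  rw [← T.mul_le_iff, T.mul_comm]

theorem one_imp (p : I) : T.imp 1 p = p :=
  eq_of_forall_le_iff fun q => by rw [T.le_imp_iff, T.mul_one]

theorem one_le_imp_iff (p q : I) : 1 ≤ T.imp p q ↔ p ≤ q := by
  rw [T.le_imp_iff, T.one_mul]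

theorem exists_lt_lt_mul {a b c : I} (h : c < T.mul a b) : ∃ a' < a, c < T.mul a' b := by
  have ha : sSup (Set.Iio a) = a :=
    le_antisymm (sSup_le fun _ h => le_of_lt h)
      (le_of_forall_lt_imp_le_of_dense fun _ h => le_sSup h)
  rw [T.mul_comm, ← ha, T.mul_sSup] at h
  obtain ⟨_, ⟨a', ha', rfl⟩, h'⟩ := lt_sSup_iff.1 h
  exact ⟨a', ha', by rwa [T.mul_comm]⟩

theorem exists_lt_one_lt_mul {b c : I} (h : c < b) : ∃ ε < 1, c < T.mul ε b :=
  T.exists_lt_lt_mul (by rwa [T.one_mul])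

theorem le_of_forall_lt_one_mul_le {b c : I} (h : ∀ ε < 1, T.mul ε b ≤ c) : b ≤ c := by
  by_contra! hlt
  obtain ⟨ε, hε, h'⟩ := T.exists_lt_one_lt_mul hlt
  exact (h ε hε).not_gt h'

theorem mul_le_of_forall_lt {a b c : I} (h : ∀ a' < a, T.mul a' b ≤ c) : T.mul a b ≤ c := by
  by_contra! hlt
  obtain ⟨a', ha', h'⟩ := T.exists_lt_lt_mul hlt
  exact (h a' ha').not_gt h'

end ContinuousTNorm

namespace IOrd

variable {T : ContinuousTNorm} {X : IOrd.{u} T} {Y : IOrd.{v} T}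

/-! ### Fuzzy inclusion, suprema and weighted joins -/

theorem le_sub_iff {A : Type u} (c : I) (φ ψ : A → I) :
    c ≤ sub T φ ψ ↔ ∀ x, T.mul c (φ x) ≤ ψ x := by
  simp only [sub, le_iInf_iff, T.le_imp_iff]

/-- The enriched Yoneda lemma. -/
theorem sub_yonedaWeight (x : X) (φ : Weight X) : sub T (yonedaWeight X x).val φ.val = φ.val x := by
  refine eq_of_forall_le_iff fun c => ?_
  rw [le_sub_iff]
  refine ⟨fun h => ?_, fun h z => (T.mul_mono_left _ h).trans (φ.lower z x)⟩
  calc c = T.mul c 1 := (T.mul_one c).symm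
    _ ≤ _ := T.mul_mono _ _ _ (X.one_le_hom_self x)
    _ ≤ _ := h x

theorem isSupremum_iff (φ : Weight X) (a : X) :
    IsSupremum φ a ↔ (∀ z, φ.val z ≤ X.hom z a) ∧
      ∀ y, sub T φ.val (yonedaWeight X y).val ≤ X.hom a y := by
  constructor
  · refine fun h => ⟨fun z => ?_, fun y => (h y).ge⟩
    have := (X.one_le_hom_self a).trans (h a).le
    rw [le_sub_iff] at this
    exact (T.one_mul _).symm.trans_le (this z)
  · rintro ⟨h₁, h₂⟩ y
    refine le_antisymm ((le_sub_iff _ _ _).2 fun z => ?_) (h₂ y)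
    exact (T.mul_mono _ _ _ (h₁ z)).trans (X.hom_trans z a y)

theorem IsSupremum.le {φ : Weight X} {a : X} (h : IsSupremum φ a) (z : X) : φ.val z ≤ X.hom z a :=
  ((isSupremum_iff φ a).1 h).1 z

theorem IsSupremum.one_le_hom {φ : Weight X} {a b : X} (ha : IsSupremum φ a)
    (hb : IsSupremum φ b) : 1 ≤ X.hom a b := by
  rw [ha b, ← hb b]
  exact X.one_le_hom_self b

theorem IsSeparated.eq_of_hom_eq (hX : X.IsSeparated) {a b : X} (h : ∀ y, X.hom a y = X.hom b y) :
    a = b :=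
  hX a b (le_inf ((X.one_le_hom_self b).trans (h b).ge) ((X.one_le_hom_self a).trans (h a).le))

/-- The weighted join `⋁ₓ φ(x) & ψₓ` of a family of weights. -/
noncomputable def Weight.bind {A : Type u} (φ : A → I) (ψ : A → Weight Y) : Weight Y where
  val y := ⨆ x, T.mul (φ x) ((ψ x).val y)
  lower y z := by
    rw [T.mul_comm, T.mul_iSup]
    refine iSup_mono fun x => ?_
    rw [T.mul_comm, T.mul_assoc]
    exact T.mul_mono _ _ _ ((ψ x).lower y z)

theorem sub_bind {A : Type u} (φ : A → I) (ψ : A → Weight Y) (χ : Y → I) :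
    sub T (Weight.bind φ ψ).val χ = sub T φ fun x => sub T (ψ x).val χ := by
  refine eq_of_forall_le_iff fun c => ?_
  simp only [le_sub_iff, Weight.bind, T.mul_iSup, iSup_le_iff, T.mul_assoc]
  exact forall_comm

theorem map_eq_bind (f : X → Y) (φ : Weight X) :
    φ.map f = Weight.bind φ.val fun x => yonedaWeight Y (f x) := rfl

theorem sub_map (f : X → Y) (φ : Weight X) (χ : Weight Y) :
    sub T (φ.map f).val χ.val = sub T φ.val fun x => χ.val (f x) := by
  simp only [map_eq_bind, sub_bind, sub_yonedaWeight]

theorem isSupremum_map_iff (f : X → Y) (φ : Weight X) (a : Y) :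
    IsSupremum (φ.map f) a ↔ ∀ y, Y.hom a y = sub T φ.val fun x => Y.hom (f x) y :=
  forall_congr' fun y => by rw [sub_map]; rfl

/-! ### Forward Cauchy weights as flat weights -/

section Flat

/-- Finitely many approximations of values of `φ` are realised by an element of nearly full
membership in `φ`. -/
def IsFlat (φ : Weight X) : Prop :=
  ∀ F : Finset (X × I), (∀ p ∈ F, p.2 < φ.val p.1) → ∀ ε < 1,
    ∃ y, ε < φ.val y ∧ ∀ p ∈ F, p.2 < X.hom p.1 y

theorem IsForwardCauchy.isFlat {φ : Weight X} (h : IsForwardCauchy φ) : IsFlat φ := by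
  obtain ⟨ι, _, _, _, x, hx, hφ⟩ := h
  intro F hF ε hε
  have h₁ : ∀ᶠ j in Filter.atTop, ε < φ.val (x j) := by
    unfold IsForwardCauchyNet at hx
    rw [← hx, lt_iSup_iff] at hε
    obtain ⟨i, hi⟩ := hε
    filter_upwards [Filter.eventually_ge_atTop i] with j hj
    refine hi.trans_le ?_
    rw [hφ]
    refine le_iSup_of_le j (le_iInf₂ fun l hl => ?_)
    exact (iInf_le _ j).trans ((iInf_le _ l).trans (iInf_le _ ⟨hj, hl⟩))
  have h₂ : ∀ᶠ j in Filter.atTop, ∀ p ∈ F, p.2 < X.hom p.1 (x j) := by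
    rw [Filter.eventually_all_finset]
    intro p hp
    have := hF p hp
    rw [hφ, lt_iSup_iff] at this
    obtain ⟨i, hi⟩ := this
    filter_upwards [Filter.eventually_ge_atTop i] with j hj
    exact hi.trans_le (iInf₂_le j hj)
  obtain ⟨j, hj₁, hj₂⟩ := (h₁.and h₂).exists
  exact ⟨x j, hj₁, hj₂⟩

/-- Recursion on finite sets of approximations: flatness gives a point serving all members of `F`
and lying above the finitely many points already chosen for `G ⊂ F`. -/
theorem IsFlat.exists_finset_net {φ : Weight X} (h : IsFlat φ) (ε : ℕ → I) (hε : ∀ n, ε n < 1) :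
    ∃ x : Finset {p : X × I // p.2 < φ.val p.1} → X, ∀ F,
      ε F.card < φ.val (x F) ∧ (∀ p ∈ F, p.1.2 < X.hom p.1.1 (x F)) ∧
        ∀ G, G ⊂ F → ε G.card < X.hom (x G) (x F) := by
  classical
  obtain ⟨x₀, -⟩ := h ∅ (by simp) (ε 0) (hε 0)
  have : Nonempty X := ⟨x₀⟩
  -- Choosing by `epsilon` lets the recursion run without carrying its invariant, which the
  -- induction below establishes.
  let step : ∀ F : Finset {p : X × I // p.2 < φ.val p.1}, (∀ G, G ⊂ F → X) → X := fun F prev =>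
    Classical.epsilon fun y => ε F.card < φ.val y ∧ (∀ p ∈ F, p.1.2 < X.hom p.1.1 y) ∧
      ∀ G, ∀ hG : G ⊂ F, ε G.card < X.hom (prev G hG) y
  let x : Finset {p : X × I // p.2 < φ.val p.1} → X := Finset.strongInduction step
  refine ⟨x, fun F => ?_⟩
  induction F using Finset.strongInduction with
  | H F ih =>
    have hxF : x F = step F fun G _ => x G := Finset.strongInduction_eq step F
    rw [hxF]
    refine Classical.epsilon_spec (p := fun y => ε F.card < φ.val y ∧
      (∀ p ∈ F, p.1.2 < X.hom p.1.1 y) ∧ ∀ G, ∀ hG : G ⊂ F, ε G.card < X.hom (x G) y) ?_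
    obtain ⟨y, hy, hy'⟩ := h (F.image Subtype.val ∪ F.ssubsets.image fun G => (x G, ε G.card))
      (by
        intro p hp
        rcases Finset.mem_union.1 hp with hp | hp
        · obtain ⟨q, -, rfl⟩ := Finset.mem_image.1 hp
          exact q.2
        · obtain ⟨G, hG, rfl⟩ := Finset.mem_image.1 hp
          exact (ih G (Finset.mem_ssubsets.1 hG)).1) _ (hε F.card)
    refine ⟨y, hy, fun p hp => ?_, fun G hG => ?_⟩
    · exact hy' p.1 (Finset.mem_union_left _ (Finset.mem_image_of_mem _ hp))
    · exact hy' (x G, ε G.card) (Finset.mem_union_right _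
        (Finset.mem_image_of_mem (fun G => (x G, ε G.card)) (Finset.mem_ssubsets.2 hG)))

theorem IsFlat.isForwardCauchy {φ : Weight X} (h : IsFlat φ) : IsForwardCauchy φ := by
  classical
  obtain ⟨ε, hmono, hε, hlim⟩ := exists_seq_strictMono_tendsto' (zero_lt_one (α := I))
  obtain ⟨x, hx⟩ := h.exists_finset_net ε fun n => (hε n).2
  -- Accuracy depends on cardinality, so arbitrarily large index sets are needed; one point of
  -- positive membership supplies an interval of thresholds.
  have hinf : Infinite {p : X × I // p.2 < φ.val p.1} := by
    obtain ⟨y, hy, -⟩ := h ∅ (by simp) 0 zero_lt_one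
    have : Infinite (Set.Ioo 0 (φ.val y)) := (Set.Ioo_infinite hy).to_subtype
    refine Infinite.of_injective
      (fun r : Set.Ioo 0 (φ.val y) => ⟨(y, r.1), r.2.2⟩) fun r s hrs => ?_
    exact Subtype.ext (congrArg (fun p => p.1.2) hrs)
  have hcard : ∀ c < 1, ∃ F₀ : Finset {p : X × I // p.2 < φ.val p.1},
      ∀ F, F₀ ⊆ F → c < ε F.card := by
    intro c hc
    obtain ⟨n, hn⟩ := (hlim.eventually_const_lt hc).exists
    obtain ⟨F₀, hF₀⟩ := Infinite.exists_subset_card_eq {p : X × I // p.2 < φ.val p.1} n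
    refine ⟨F₀, fun F hF => hn.trans_le (hmono.monotone ?_)⟩
    rw [← hF₀]
    exact Finset.card_le_card hF
  refine ⟨Finset {p : X × I // p.2 < φ.val p.1}, inferInstance, inferInstance, inferInstance,
    x, ?_, fun z => ?_⟩
  · refine le_antisymm unitInterval.le_one' (le_of_forall_lt_imp_le_of_dense fun c hc => ?_)
    obtain ⟨F₀, hF₀⟩ := hcard c hc
    refine le_iSup_of_le F₀ (le_iInf fun G => le_iInf fun F => le_iInf fun hGF => ?_)
    rcases eq_or_ssubset_of_subset hGF.2 with rfl | hne
    · exact hc.le.trans (X.one_le_hom_self _)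
    · exact (hF₀ G hGF.1).le.trans ((hx F).2.2 G hne).le
  · refine le_antisymm (le_of_forall_lt_imp_le_of_dense fun c hc => ?_) (iSup_le fun F₁ => ?_)
    · refine le_iSup_of_le {⟨(z, c), hc⟩} (le_iInf₂ fun F hF => ?_)
      exact ((hx F).2.1 ⟨(z, c), hc⟩ (hF (Finset.mem_singleton_self _))).le
    · refine T.le_of_forall_lt_one_mul_le fun c hc => ?_
      obtain ⟨F₀, hF₀⟩ := hcard c hc
      refine (T.mul_le_mul ?_ (iInf₂_le (F₀ ∪ F₁) Finset.subset_union_right)).trans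
        (φ.lower z (x (F₀ ∪ F₁)))
      exact (hF₀ _ Finset.subset_union_left).le.trans (hx _).1.le

/-- Forward Cauchy weights are closed under forward Cauchy weighted joins. -/
theorem IsForwardCauchy.bind {φ : Weight X} (hφ : IsForwardCauchy φ) (ψ : X → Weight Y)
    (hψ : ∀ x, IsForwardCauchy (ψ x)) (hmono : ∀ x y, X.hom x y ≤ sub T (ψ x).val (ψ y).val) :
    IsForwardCauchy (Weight.bind φ.val ψ) := by
  classical
  refine IsFlat.isForwardCauchy fun F hF ε hε => ?_
  have key : ∀ p : Y × I, ∃ q : X × I, p ∈ F →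
      q.2 < φ.val q.1 ∧ p.2 < T.mul q.2 ((ψ q.1).val p.1) := by
    intro p
    by_cases hp : p ∈ F
    · obtain ⟨x, hx⟩ := lt_iSup_iff.1 (hF p hp)
      obtain ⟨a, ha, ha'⟩ := T.exists_lt_lt_mul hx
      exact ⟨(x, a), fun _ => ⟨ha, ha'⟩⟩
    · obtain ⟨x, -⟩ := hφ.isFlat ∅ (by simp) ε hε
      exact ⟨(x, 0), fun h => absurd h hp⟩
  choose q hq using key
  -- Splits `ε < η & δ`: `η` bounds membership of `x` in `φ`, `δ` that of `y` in `ψ x`.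
  obtain ⟨δ, hδ, hεδ⟩ := T.exists_lt_one_lt_mul hε
  rw [T.mul_one] at hεδ
  obtain ⟨η, hη, hδη⟩ := T.exists_lt_one_lt_mul hεδ
  obtain ⟨x, hx, hx'⟩ := hφ.isFlat (F.image q) (by
    intro r hr
    obtain ⟨p, hp, rfl⟩ := Finset.mem_image.1 hr
    exact (hq p hp).1) η hη
  obtain ⟨y, hy, hy'⟩ := (hψ x).isFlat F (by
    intro p hp
    refine (hq p hp).2.trans_le ?_
    have := (hx' _ (Finset.mem_image_of_mem q hp)).le.trans (hmono (q p).1 x)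
    exact (le_sub_iff _ _ _).1 this p.1) δ hδ
  exact ⟨y, (hδη.trans_le (T.mul_le_mul hx.le hy.le)).trans_le
    (le_iSup (fun x => T.mul (φ.val x) ((ψ x).val y)) x), hy'⟩

theorem IsForwardCauchy.map {φ : Weight X} (hφ : IsForwardCauchy φ) {f : X → Y}
    (hf : PreservesOrder f) : IsForwardCauchy (φ.map f) := by
  rw [map_eq_bind]
  refine hφ.bind _ (fun x => isForwardCauchy_yonedaWeight Y (f x)) fun x y => ?_
  rw [sub_yonedaWeight]
  exact hf x y

end Flat

/-! ### Completeness, its dual, and retracts -/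

section Completeness

theorem IsCocomplete.op (h : X.IsCocomplete) : X.op.IsCocomplete := by
  intro φ
  -- The weight of lower bounds of `φ`; its supremum is the infimum of `φ`.
  let ψ : Weight X :=
    { val := fun x => sub T φ.val (X.hom x)
      lower := fun x y => (le_sub_iff _ _ _).2 fun z => by
        have : T.mul (sub T φ.val (X.hom y)) (φ.val z) ≤ X.hom y z := (le_sub_iff _ _ _).1 le_rfl z
        calc T.mul (T.mul (sub T φ.val (X.hom y)) (X.hom x y)) (φ.val z)
            = T.mul (T.mul (sub T φ.val (X.hom y)) (φ.val z)) (X.hom x y) := by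
              rw [T.mul_assoc, T.mul_comm (X.hom x y), ← T.mul_assoc]
          _ ≤ _ := T.mul_mono_left _ this
          _ ≤ _ := X.hom_trans x y z }
  obtain ⟨a, ha⟩ := h ψ
  refine ⟨a, (isSupremum_iff _ _).2 ⟨fun z => ?_, fun y => ha.le y⟩⟩
  change φ.val z ≤ X.hom a z
  rw [ha z, le_sub_iff]
  intro x
  rw [T.mul_comm]
  exact (le_sub_iff _ _ _).1 (le_refl (ψ.val x)) z

theorem IsComplete.isCocomplete (h : X.IsComplete) : X.IsCocomplete := IsCocomplete.op (X := X.op) h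

theorem IsCocomplete.of_retract (hY : Y.IsCocomplete) {s : X → Y} {r : Y → X}
    (hs : PreservesOrder s) (hr : PreservesOrder r) (hrs : ∀ x, r (s x) = x) : X.IsCocomplete := by
  intro φ
  obtain ⟨b, hb⟩ := hY (φ.map s)
  rw [isSupremum_map_iff] at hb
  refine ⟨r b, (isSupremum_iff _ _).2 ⟨fun z => ?_, fun y => ?_⟩⟩
  · have h := (Y.one_le_hom_self b).trans (hb b).le
    rw [le_sub_iff] at h
    have h' := (h z).trans (hr (s z) b)
    rwa [T.one_mul, hrs] at h'
  · calc sub T φ.val (yonedaWeight X y).val ≤ sub T φ.val fun x => Y.hom (s x) (s y) :=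
          iInf_mono fun x => T.imp_mono le_rfl (hs x y)
      _ = Y.hom b (s y) := (hb _).symm
      _ ≤ X.hom (r b) (r (s y)) := hr _ _
      _ = _ := by rw [hrs]

theorem IsSeparated.of_retract (hY : Y.IsSeparated) {s : X → Y} {r : Y → X}
    (hs : PreservesOrder s) (hrs : ∀ x, r (s x) = x) : X.IsSeparated := fun x y h => by
  rw [← hrs x, ← hrs y, hY (s x) (s y) (h.trans (inf_le_inf (hs _ _) (hs _ _)))]

end Completeness

/-! ### Domains via way-below weights, and their retracts -/

section Domain

/-- A weight-valued form of "the elements way below `x` form an ideal with supremum `x`". -/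
def IsWayBelowWeight (ψ : Weight X) (x : X) : Prop :=
  IsForwardCauchy ψ ∧ IsSupremum ψ x ∧ ∀ φ : Weight X, IsForwardCauchy φ → ∀ a, IsSupremum φ a →
    X.hom x a ≤ sub T ψ.val φ.val

/-- Half of `d ⊣ sup` follows from `d x` having supremum `x`; the other half is the way-below
inequality. -/
theorem isDomain_iff : X.IsDomain ↔ X.IsSeparated ∧
    (∀ φ : Weight X, IsForwardCauchy φ → ∃ a, IsSupremum φ a) ∧
      ∀ x, ∃ ψ : Weight X, IsWayBelowWeight ψ x := by
  constructor
  · rintro ⟨hsep, d, sup, hd, hsup⟩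
    have hs : ∀ φ, IsSupremum φ.1 (sup φ) := fun φ y => hsup φ y
    refine ⟨hsep, fun φ hφ => ⟨sup ⟨φ, hφ⟩, hs ⟨φ, hφ⟩⟩, fun x => ⟨(d x).1, (d x).2, ?_, ?_⟩⟩
    · intro y
      have h : sup (X.yoneda y) = y := hsep.eq_of_hom_eq fun z => by
        rw [hs (X.yoneda y) z]; exact sub_yonedaWeight _ _
      have h' := hd x (X.yoneda y)
      rw [h] at h'
      exact h'.symm
    · intro φ hφ a ha
      have h : a = sup ⟨φ, hφ⟩ := hsep.eq_of_hom_eq fun z => by rw [ha z, hs ⟨φ, hφ⟩ z]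
      rw [h]
      exact (hd x ⟨φ, hφ⟩).ge
  · rintro ⟨hsep, hsup, hway⟩
    choose d hd using hway
    choose sup hs using fun φ : forwardCauchyWeights X => hsup φ.1 φ.2
    refine ⟨hsep, fun x => ⟨d x, (hd x).1⟩, sup, fun x φ => le_antisymm ?_ ?_, fun φ y => hs φ y⟩
    · change sub T (d x).val φ.1.val ≤ X.hom x (sup φ)
      rw [(hd x).2.1]
      exact iInf_mono fun z => T.imp_mono le_rfl ((hs φ).le z)
    · exact (hd x).2.2 φ.1 φ.2 _ (hs φ)

theorem IsWayBelowWeight.map {s : X → Y} {r : Y → X} (hs : IsScottContinuous s)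
    (hr : IsScottContinuous r) (hrs : ∀ x, r (s x) = x) {ψ : Weight Y} {x : X}
    (h : IsWayBelowWeight ψ (s x)) : IsWayBelowWeight (ψ.map r) x := by
  refine ⟨h.1.map hr.1, ?_, fun φ hφ a ha => ?_⟩
  · rw [← hrs x]
    exact hr.2 ψ h.1 _ h.2.1
  · refine (hs.1 x a).trans ((h.2.2 _ (hφ.map hs.1) _ (hs.2 φ hφ a ha)).trans ?_)
    rw [sub_map]
    refine iInf_mono fun p => T.imp_mono le_rfl (iSup_le fun z => ?_)
    refine (T.mul_mono _ _ _ (hr.1 p (s z))).trans ?_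
    rw [hrs]
    exact φ.lower _ _

theorem IsContinuousLattice.of_isRetract {Y : IOrd.{v} T} (hY : Y.IsContinuousLattice)
    (h : X.IsRetract Y) : X.IsContinuousLattice := by
  obtain ⟨s, r, hs, hr, hrs⟩ := h
  have hsep := hY.1.1.of_retract hs.1 hrs
  have hco := hY.1.2.isCocomplete.of_retract hs.1 hr.1 hrs
  refine ⟨⟨hsep, hco.op⟩, isDomain_iff.2 ⟨hsep, fun φ _ => hco φ, fun x => ?_⟩⟩
  obtain ⟨ψ, hψ⟩ := (isDomain_iff.1 hY.2).2.2 (s x)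
  exact ⟨_, hψ.map hs hr hrs⟩

end Domain

/-! ### The cube is a continuous lattice -/

section Power

variable {A : Type u}

theorem pi_alphaL_isSeparated : (IOrd.pi fun _ : A => alphaL T).IsSeparated := by
  intro x y h
  rw [le_inf_iff] at h
  exact funext fun i => le_antisymm (α := I) ((T.one_le_imp_iff _ _).1 (h.1.trans (iInf_le _ i)))
    ((T.one_le_imp_iff _ _).1 (h.2.trans (iInf_le _ i)))

theorem isSupremum_pi_alphaL (φ : Weight (IOrd.pi fun _ : A => alphaL T)) :
    IsSupremum φ fun i => (⨆ z, T.mul (φ.val z) (z i) : I) := by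
  have key : ∀ (f : (A → I) → I) (y : A → I),
      ⨅ i, T.imp (⨆ z : A → I, T.mul (f z) (z i)) (y i) =
        ⨅ z : A → I, T.imp (f z) (⨅ i, T.imp (z i) (y i)) := fun f y => by
    refine eq_of_forall_le_iff fun c => ?_
    simp only [le_iInf_iff, T.le_imp_iff, T.mul_iSup, iSup_le_iff, T.mul_assoc]
    exact forall_comm
  exact fun y => key φ.val y

theorem pi_alphaL_isCocomplete : (IOrd.pi fun _ : A => alphaL T).IsCocomplete := fun φ =>
  ⟨_, isSupremum_pi_alphaL φ⟩

theorem pi_alphaL_hom_le (x y : A → I) (i : A) :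
    (IOrd.pi fun _ : A => alphaL T).hom x y ≤ T.imp (x i) (y i) := iInf_le _ i

theorem pi_alphaL_hom_eq_one {x y : A → I} (h : x ≤ y) :
    (IOrd.pi fun _ : A => alphaL T).hom x y = 1 :=
  le_antisymm unitInterval.le_one' (le_iInf fun i => (T.one_le_imp_iff _ _).2 (h i))

/-- The finitely supported points of the cube that lie strictly below `x` on their support. -/
def finiteBelow (x : A → I) : Set (A → I) :=
  {u | {i | u i ≠ 0}.Finite ∧ ∀ i, u i = 0 ∨ u i < x i}

theorem le_of_mem_finiteBelow {x u : A → I} (h : u ∈ finiteBelow x) : u ≤ x := fun i =>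
  (h.2 i).elim (fun h => h.le.trans unitInterval.nonneg') le_of_lt

theorem zero_mem_finiteBelow (x : A → I) : (fun _ => 0) ∈ finiteBelow x := by
  simp [finiteBelow]

theorem sup_mem_finiteBelow {x u w : A → I} (hu : u ∈ finiteBelow x) (hw : w ∈ finiteBelow x) :
    u ⊔ w ∈ finiteBelow x := by
  refine ⟨(hu.1.union hw.1).subset fun i hi => ?_, fun i => ?_⟩
  · by_contra hc
    simp only [Set.mem_union, Set.mem_ofPred_eq, not_or, not_not] at hc
    exact hi (by simp [hc.1, hc.2])
  · rcases le_total (u i) (w i) with h | h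
    · simpa [h] using hw.2 i
    · simpa [h] using hu.2 i

theorem update_mem_finiteBelow [DecidableEq A] {x : A → I} {i : A} {t : I} (h : t < x i) :
    Function.update (fun _ => 0) i t ∈ finiteBelow x := by
  refine ⟨(Set.finite_singleton i).subset fun j hj => ?_, fun j => ?_⟩
  · by_contra hc
    exact hj (by simp [Function.update_of_ne hc])
  · by_cases hj : j = i
    · subst hj; simp [h]
    · simp [Function.update_of_ne hj]

/-- The weight generated by the finitely supported points below `x`. -/
noncomputable def finiteBelowWeight (T : ContinuousTNorm) (x : A → I) :
    Weight (IOrd.pi fun _ : A => alphaL T) where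
  val z := ⨆ u : finiteBelow x, (IOrd.pi fun _ : A => alphaL T).hom z u.1
  lower y z := by
    rw [T.mul_comm, T.mul_iSup]
    refine iSup_mono fun u => ?_
    rw [T.mul_comm]
    exact IOrd.hom_trans _ _ _ _

theorem isForwardCauchy_finiteBelowWeight (x : A → I) :
    IsForwardCauchy (finiteBelowWeight T x) := by
  have hdir : IsDirectedOrder (finiteBelow x) :=
    ⟨fun u w => ⟨⟨u.1 ⊔ w.1, sup_mem_finiteBelow u.2 w.2⟩, le_sup_left (a := u.1),
      le_sup_right (a := u.1)⟩⟩
  refine ⟨finiteBelow x, inferInstance, hdir, ⟨⟨_, zero_mem_finiteBelow x⟩⟩, fun u => u.1, ?_, ?_⟩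
  · refine le_antisymm unitInterval.le_one' (le_iSup_of_le ⟨_, zero_mem_finiteBelow x⟩ ?_)
    exact le_iInf fun u => le_iInf fun w => le_iInf fun h => (pi_alphaL_hom_eq_one h.2).ge
  · refine fun z => le_antisymm (iSup_mono fun u => le_iInf₂ fun w hw => ?_)
      (iSup_mono fun u => iInf₂_le u le_rfl)
    refine le_trans ?_ (IOrd.hom_trans _ z u.1 w.1)
    rw [pi_alphaL_hom_eq_one hw, T.one_mul]

theorem isSupremum_finiteBelowWeight (x : A → I) : IsSupremum (finiteBelowWeight T x) x := by
  classical
  refine (isSupremum_iff _ _).2 ⟨fun z => iSup_le fun u => ?_, fun y => le_iInf fun i => ?_⟩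
  · refine le_trans ?_ (IOrd.hom_trans _ z u.1 x)
    rw [pi_alphaL_hom_eq_one (le_of_mem_finiteBelow u.2), T.one_mul]
  · change _ ≤ T.imp (x i) (y i)
    refine (T.mul_le_iff _ _ _).1 (T.mul_le_of_forall_lt fun t ht => (T.mul_le_iff _ _ _).2 ?_)
    -- Points supported on one coordinate already recover `x i`.
    let u : A → I := Function.update (fun _ => 0) i t
    have hu : 1 ≤ (finiteBelowWeight T x).val u :=
      le_iSup_of_le ⟨u, update_mem_finiteBelow ht⟩ (pi_alphaL_hom_eq_one le_rfl).ge
    calc _ ≤ T.imp ((finiteBelowWeight T x).val u)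
            ((IOrd.pi fun _ : A => alphaL T).hom u y) := iInf_le _ u
      _ ≤ T.imp 1 ((IOrd.pi fun _ : A => alphaL T).hom u y) := T.imp_mono hu le_rfl
      _ ≤ T.imp (u i) (y i) := (T.one_imp _).le.trans (pi_alphaL_hom_le _ _ i)
      _ = T.imp t (y i) := by simp [u]

/-- In a coordinate, membership in a forward Cauchy weight with supremum `a` forces the
approximation of `x i → a i`; this is where continuity off the diagonal enters. -/
theorem exists_forall_lt_hom_le_imp (hS : T.ConditionS)
    {φ : Weight (IOrd.pi fun _ : A => alphaL T)} (hφ : IsForwardCauchy φ) {a : A → I}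
    (ha : IsSupremum φ a) (i : A) {s t c : I} (hst : s < t) (hc : c < T.imp t (a i)) :
    ∃ (z : A → I) (r : I), r < φ.val z ∧ ∀ w : A → I,
      r < (IOrd.pi fun _ : A => alphaL T).hom z w → c ≤ T.imp s (w i) := by
  -- The gap `s < t` leaves room to move off the diagonal.
  obtain ⟨p, hsp, hpa, hcp⟩ : ∃ p, s ≤ p ∧ p ≠ a i ∧ c < T.imp p (a i) := by
    by_cases h : t = a i
    · exact ⟨s, le_rfl, (hst.trans_eq h).ne, hc.trans_le (T.imp_mono hst.le le_rfl)⟩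
    · exact ⟨t, hst.le, h, hc⟩
  by_cases ha0 : a i = 0
  · obtain ⟨z, hz, -⟩ := hφ.isFlat ∅ (by simp) 0 zero_lt_one
    refine ⟨z, 0, hz, fun w _ => hcp.le.trans (T.imp_mono hsp ?_)⟩
    rw [ha0]
    exact unitInterval.nonneg'
  have hcont : ContinuousAt (fun w => T.imp p w) (a i) :=
    (hS p (a i) hpa).comp (f := fun w => (p, w)) (by fun_prop)
  -- Continuity lowers `a i` to some `m < a i`, which a single term `φ(z) & z i` of the supremum
  -- then exceeds.
  obtain ⟨l, hl, hsub⟩ := exists_Ioc_subset_of_mem_nhds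
    (hcont.eventually_const_lt hcp) ⟨0, unitInterval.pos_iff_ne_zero.2 ha0⟩
  obtain ⟨m, hlm, hma⟩ := exists_between hl
  have hcm : c < T.imp p m := hsub ⟨hlm, hma.le⟩
  have hle : a i ≤ ⨆ z : A → I, T.mul (φ.val z) (z i) :=
    (T.one_le_imp_iff _ _).1 ((ha.one_le_hom (isSupremum_pi_alphaL φ)).trans (iInf_le _ i))
  obtain ⟨z, hz⟩ := lt_iSup_iff.1 (hma.trans_le hle)
  obtain ⟨r, hr, hmr⟩ := T.exists_lt_lt_mul hz
  refine ⟨z, r, hr, fun w hw => hcm.le.trans (T.imp_mono hsp (hmr.le.trans ?_))⟩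
  rw [← T.le_imp_iff]
  exact hw.le.trans (pi_alphaL_hom_le z w i)

/-- Only the finite support of `w` imposes conditions, so flatness gives one `y` meeting them all.
-/
theorem hom_le_of_mem_finiteBelow (hS : T.ConditionS)
    {φ : Weight (IOrd.pi fun _ : A => alphaL T)} (hφ : IsForwardCauchy φ) {a x w : A → I}
    (ha : IsSupremum φ a) (hw : w ∈ finiteBelow x) :
    (IOrd.pi fun _ : A => alphaL T).hom x a ≤ φ.val w := by
  classical
  refine le_of_forall_lt_imp_le_of_dense fun c hc => T.le_of_forall_lt_one_mul_le fun ε hε => ?_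
  have key : ∀ i : {i // w i ≠ 0}, ∃ q : (A → I) × I, q.2 < φ.val q.1 ∧ ∀ y : A → I,
      q.2 < (IOrd.pi fun _ : A => alphaL T).hom q.1 y → c ≤ T.imp (w i) (y i) := fun i => by
    obtain ⟨z, r, h⟩ := exists_forall_lt_hom_le_imp hS hφ ha i ((hw.2 i).resolve_left i.2)
      (hc.trans_le (pi_alphaL_hom_le x a i))
    exact ⟨(z, r), h⟩
  choose q hq hq' using key
  have : Fintype {i // w i ≠ 0} := hw.1.fintype
  obtain ⟨y, hy, hy'⟩ := hφ.isFlat (Finset.univ.image q) (by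
    intro p hp
    obtain ⟨i, -, rfl⟩ := Finset.mem_image.1 hp
    exact hq i) ε hε
  refine (T.mul_le_mul hy.le (le_iInf fun i => ?_)).trans (φ.lower w y)
  change c ≤ T.imp (w i) (y i)
  by_cases hi : w i = 0
  · rw [hi]
    exact unitInterval.le_one'.trans ((T.one_le_imp_iff _ _).2 unitInterval.nonneg')
  · exact hq' ⟨i, hi⟩ y (hy' _ (Finset.mem_image_of_mem q (Finset.mem_univ _)))

theorem isWayBelowWeight_finiteBelowWeight (hS : T.ConditionS) (x : A → I) :
    IsWayBelowWeight (finiteBelowWeight T x) x := by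
  refine ⟨isForwardCauchy_finiteBelowWeight x, isSupremum_finiteBelowWeight x,
    fun φ hφ a ha => (le_sub_iff _ _ _).2 fun z => ?_⟩
  rw [finiteBelowWeight, T.mul_iSup]
  exact iSup_le fun u => (T.mul_mono_left _ (hom_le_of_mem_finiteBelow hS hφ ha u.2)).trans
    (φ.lower z u.1)

theorem pi_alphaL_isContinuousLattice (hS : T.ConditionS) :
    (IOrd.pi fun _ : A => alphaL T).IsContinuousLattice :=
  ⟨⟨pi_alphaL_isSeparated, pi_alphaL_isCocomplete.op⟩, isDomain_iff.2
    ⟨pi_alphaL_isSeparated, fun φ _ => pi_alphaL_isCocomplete φ,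
      fun x => ⟨_, isWayBelowWeight_finiteBelowWeight hS x⟩⟩⟩

end Power

/-! ### A continuous lattice as a retract of a cube -/

section Embedding

theorem isScottContinuous_of_isWayBelowWeight {d : X → Weight X}
    (hd : ∀ x, IsWayBelowWeight (d x) x) :
    IsScottContinuous (Y := IOrd.pi fun _ : X => alphaL T) fun x => (d x).val := by
  have hmono : ∀ x y, X.hom x y ≤ sub T (d x).val (d y).val := fun x y =>
    (hd x).2.2 _ (hd y).1 y (hd y).2.1
  refine ⟨hmono, fun φ hφ a ha => ?_⟩
  -- Interpolation: the join of the `d x` weighted by `φ` is forward Cauchy with supremum `a`, so it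
  -- contains `d a`, hence equals it.
  have hsup : IsSupremum (Weight.bind φ.val d) a := fun y => by
    rw [sub_bind, ha y]
    exact congrArg _ (funext fun x => (hd x).2.1 y)
  have h₁ : 1 ≤ sub T (d a).val (Weight.bind φ.val d).val :=
    (X.one_le_hom_self a).trans
      ((hd a).2.2 _ (hφ.bind d (fun x => (hd x).1) hmono) a hsup)
  have h₂ : (d a).val = (Weight.bind φ.val d).val := by
    refine funext fun z => le_antisymm ?_ (iSup_le fun x => ?_)
    · simpa [T.one_mul] using (le_sub_iff _ _ _).1 h₁ z
    · exact (le_sub_iff _ _ _).1 ((ha.le x).trans (hmono x a)) z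
  refine (isSupremum_map_iff _ _ _).2 fun y => ?_
  exact (congrArg (fun f => sub T f y) h₂).trans (sub_bind φ.val d y)

/-- The hypothesis makes `r` left adjoint to `y ↦ X(-,y)`, so it preserves all weighted suprema. -/
theorem isScottContinuous_of_hom_eq_sub {r : (X → I) → X}
    (hr : ∀ w y, X.hom (r w) y = sub T w (yonedaWeight X y).val) :
    IsScottContinuous (X := IOrd.pi fun _ : X => alphaL T) r := by
  have hunit : ∀ (w : X → I) z, w z ≤ X.hom z (r w) := fun w z => by
    have := (le_sub_iff _ _ _).1 ((X.one_le_hom_self (r w)).trans (hr w (r w)).le) z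
    rwa [T.one_mul] at this
  refine ⟨fun w w' => ?_, fun φ _ a ha => ?_⟩
  · exact (iInf_mono fun z => T.imp_mono le_rfl (hunit w' z)).trans (hr w (r w')).ge
  · refine (isSupremum_map_iff _ _ _).2 fun y => ?_
    refine (hr a y).trans ((ha (yonedaWeight X y).val).trans ?_)
    exact congrArg _ (funext fun w => (hr w y).symm)

theorem IsContinuousLattice.isRetract_pi_alphaL (h : X.IsContinuousLattice) :
    X.IsRetract (IOrd.pi fun _ : X => alphaL T) := by
  choose d hd using (isDomain_iff.1 h.2).2.2
  -- An arbitrary `w` need not be a weight; the weight it generates has the same upper bounds.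
  choose r hr using fun w : X → I =>
    h.1.2.isCocomplete (Weight.bind w fun x => yonedaWeight X x)
  have hr' : ∀ w y, X.hom (r w) y = sub T w (yonedaWeight X y).val := fun w y => by
    simp only [hr w y, sub_bind, sub_yonedaWeight]
  refine ⟨_, r, isScottContinuous_of_isWayBelowWeight hd,
    isScottContinuous_of_hom_eq_sub hr', fun x => h.1.1.eq_of_hom_eq fun y => ?_⟩
  rw [hr', (hd x).2.1 y]

end Embedding

end IOrd

theorem mainTheorem8 (T : ContinuousTNorm) (hS : T.ConditionS) (X : IOrd.{u} T) :
    X.IsContinuousLattice ↔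
      ∃ A : Type u, X.IsRetract (IOrd.pi fun _ : A => IOrd.alphaL T) :=
  ⟨fun h => ⟨X, h.isRetract_pi_alphaL⟩, fun ⟨_, h⟩ =>
    (IOrd.pi_alphaL_isContinuousLattice hS).of_isRetract h⟩
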